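/- Let $\mathcal{R}$ be a von Neumann algebra acting on a complex Hilbert space $\mathcal{H}$, with unit $I = \mathrm{id}_{\mathcal{H}}$; let $\mathcal{R}_{sa}$ be the set of its self-adjoint elements and $\mathcal{P}(\mathcal{R})$ the complete lattice of its projections. A dual ideal of $\mathcal{P}(\mathcal{R})$ is a nonempty subset $\mathcal{J} \subseteq \mathcal{P}(\mathcal{R})$ such that $0 \notin \mathcal{J}$; $P, Q \in \mathcal{J}$ implies $P \wedge Q \in \mathcal{J}$; and $P \in \mathcal{J}$, $P \le Q$ implies $Q \in \mathcal{J}$. Let $\mathcal{D}(\mathcal{R})$ be the set of all dual ideals of $\mathcal{P}(\mathcal{R})$, with the topology that has the sets $\mathcal{D}_P(\mathcal{R}) = \{\mathcal{J} \in \mathcal{D}(\mathcal{R}) : P \in \mathcal{J}\}$, $P \in \mathcal{P}(\mathcal{R})$, as a basis. For $A \in \mathcal{R}_{sa}$ with (right-continuous) spectral family $E^A = (E^A_\lambda)_{\lambda \in \mathbb{R}}$, $E^A_\lambda = \chi_{(-\infty,\lambda]}(A) \in \mathcal{P}(\mathcal{R})$, let $f_A : \mathcal{D}(\mathcal{R})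 \to \mathbb{R}$ be the function $$f_A(\mathcal{J}) = \inf\{\lambda \in \mathbb{R} : E^A_\lambda \in \mathcal{J}\}.$$ Let $f : \mathcal{D}(\mathcal{R}) \to \mathbb{R}$ be an upper semicontinuous function that satisfies the intersection condition $$f\Big(\bigcap_{j \in J} \mathcal{J}_j\Big) = \sup_{j \in J} f(\mathcal{J}_j)$$ for every nonempty family $(\mathcal{J}_j)_{j \in J}$ in $\mathcal{D}(\mathcal{R})$. Then there is a unique $A \in \mathcal{R}_{sa}$ such that $f = f_A$. -/

import Mathlib

noncomputable section

/-! ### Dual ideals of a complete lattice -/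

/-- A dual ideal of a complete lattice: a nonempty subset that does not contain `0`, is closed
under binary meets and is upward closed. -/
structure DualIdeal (L : Type*) [CompleteLattice L] where
  carrier : Set L
  nonempty' : carrier.Nonempty
  bot_notMem' : ⊥ ∉ carrier
  inf_mem' : ∀ {a b : L}, a ∈ carrier → b ∈ carrier → a ⊓ b ∈ carrier
  mem_of_le' : ∀ {a b : L}, a ∈ carrier → a ≤ b → b ∈ carrier

namespace DualIdeal

instance {L : Type*} [CompleteLattice L] : SetLike (DualIdeal L) L where
  coe := DualIdeal.carrier
  coe_injective I J h := by
    cases I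
    cases J
    congr

/-- `D_a(L)`, the set of all dual ideals that contain `a`. -/
def basic {L : Type*} [CompleteLattice L] (a : L) : Set (DualIdeal L) :=
  {J | a ∈ J}

/-- The topology on the space of dual ideals with basis the sets `D_a(L)`, `a ∈ L`. -/
instance {L : Type*} [CompleteLattice L] : TopologicalSpace (DualIdeal L) :=
  TopologicalSpace.generateFrom (Set.range basic)

/-- The intersection of a nonempty set of dual ideals is a dual ideal. -/
def sInter {L : Type*} [CompleteLattice L] (S : Set (DualIdeal L)) (hS : S.Nonempty) :
    DualIdeal L where
  carrier := {a | ∀ J ∈ S, a ∈ J}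
  nonempty' := ⟨⊤, fun J _ => J.nonempty'.elim fun _ ha => J.mem_of_le' ha le_top⟩
  bot_notMem' := fun h => hS.elim fun J hJ => J.bot_notMem' (h J hJ)
  inf_mem' := fun ha hb J hJ => J.inf_mem' (ha J hJ) (hb J hJ)
  mem_of_le' := fun ha hab J hJ => J.mem_of_le' (ha J hJ) hab

/-- An abstract observable function on the space of dual ideals: an upper semicontinuous real
function which satisfies the intersection condition `f (⋂ J_j) = sup f (J_j)` for all nonempty
families of dual ideals. (A family enters only through the set of its members; the supremum is
a genuine least upper bound in `ℝ`.) -/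
structure IsAbstractObservable {L : Type*} [CompleteLattice L] (f : DualIdeal L → ℝ) :
    Prop where
  upperSemicontinuous : UpperSemicontinuous f
  intersection : ∀ (S : Set (DualIdeal L)) (hS : S.Nonempty), IsLUB (f '' S) (f (sInter S hS))

end DualIdeal

/-! ### The projection lattice of a von Neumann algebra -/

namespace VonNeumannAlgebra

/-- The set `P(R)` of all (orthogonal) projections in the von Neumann algebra `R`. -/
def Projections {H : Type*} [NormedAddCommGroup H] [InnerProductSpace ℂ H] [CompleteSpace H]
    (R : VonNeumannAlgebra H) : Type _ :=
  {P : H →L[ℂ] H // IsStarProjection P ∧ P ∈ R}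

/-- Projections are ordered by the usual order of self-adjoint operators. -/
instance {H : Type*} [NormedAddCommGroup H] [InnerProductSpace ℂ H] [CompleteSpace H]
    (R : VonNeumannAlgebra H) : PartialOrder R.Projections :=
  inferInstanceAs (PartialOrder {P : H →L[ℂ] H // IsStarProjection P ∧ P ∈ R})

theorem Projections.le_iff_range {H : Type*} [NormedAddCommGroup H] [InnerProductSpace ℂ H]
    [CompleteSpace H] {R : VonNeumannAlgebra H} (P Q : R.Projections) :
    P ≤ Q ↔ P.1.range ≤ Q.1.range := by
  change P.1 ≤ Q.1 ↔ _
  obtain ⟨_, hP⟩ := isStarProjection_iff_eq_starProjection_range.mp P.2.1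
  obtain ⟨_, hQ⟩ := isStarProjection_iff_eq_starProjection_range.mp Q.2.1
  conv_lhs => rw [hP, hQ]
  exact Submodule.starProjection_le_starProjection_iff

theorem starProjection_mem {H : Type*} [NormedAddCommGroup H] [InnerProductSpace ℂ H]
    [CompleteSpace H] (R : VonNeumannAlgebra H) (K : Submodule ℂ H) [K.HasOrthogonalProjection]
    (hK : ∀ y ∈ R.commutant, ∀ x ∈ K, y x ∈ K) : K.starProjection ∈ R := by
  rw [VonNeumannAlgebra.IsStarProjection.mem_iff isStarProjection_starProjection]
  intro y hy
  rw [Submodule.range_starProjection]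
  exact fun x hx => hK y hy x hx

theorem Projections.apply_mem_range {H : Type*} [NormedAddCommGroup H] [InnerProductSpace ℂ H]
    [CompleteSpace H] {R : VonNeumannAlgebra H} (P : R.Projections) (y : H →L[ℂ] H)
    (hy : y ∈ R.commutant) (x : H) (hx : x ∈ P.1.range) : y x ∈ P.1.range :=
  (VonNeumannAlgebra.IsStarProjection.mem_iff P.2.1 R).mp P.2.2 y hy hx

theorem Projections.isClosed_range {H : Type*} [NormedAddCommGroup H] [InnerProductSpace ℂ H]
    [CompleteSpace H] {R : VonNeumannAlgebra H} (P : R.Projections) :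
    IsClosed (P.1.range : Set H) :=
  ContinuousLinearMap.IsIdempotentElem.isClosed_range P.2.1.isIdempotentElem

instance {H : Type*} [NormedAddCommGroup H] [InnerProductSpace ℂ H] [CompleteSpace H]
    {R : VonNeumannAlgebra H} (S : Set R.Projections) :
    CompleteSpace (⨅ P ∈ S, P.1.range : Submodule ℂ H) := by
  have h : IsClosed ((⨅ P ∈ S, P.1.range : Submodule ℂ H) : Set H) := by
    simp only [Submodule.coe_iInf]
    exact isClosed_iInter fun P => isClosed_iInter fun _ => P.isClosed_range
  exact h.completeSpace_coe

/-- The meet of a set of projections is the projection onto the intersection of the ranges. -/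
instance {H : Type*} [NormedAddCommGroup H] [InnerProductSpace ℂ H] [CompleteSpace H]
    (R : VonNeumannAlgebra H) : InfSet R.Projections where
  sInf S :=
    ⟨(⨅ P ∈ S, P.1.range : Submodule ℂ H).starProjection, isStarProjection_starProjection,
      R.starProjection_mem _ fun y hy x hx => by
        simp only [Submodule.mem_iInf] at hx ⊢
        exact fun P hP => P.apply_mem_range y hy x (hx P hP)⟩

instance {H : Type*} [NormedAddCommGroup H] [InnerProductSpace ℂ H] [CompleteSpace H]
    (R : VonNeumannAlgebra H) : CompleteLattice R.Projections :=
  completeLatticeOfInf R.Projections fun S => by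
    have h : (sInf S).1.range = (⨅ P ∈ S, P.1.range : Submodule ℂ H) :=
      Submodule.range_starProjection _
    constructor
    · intro P hP
      rw [Projections.le_iff_range, h]
      exact iInf₂_le P hP
    · intro Q hQ
      rw [Projections.le_iff_range, h]
      exact le_iInf₂ fun P hP => (Projections.le_iff_range Q P).mp (hQ hP)

/-! ### The spectral family and the observable function of a self-adjoint element -/

/-- `E^A_λ`, the value at `λ` of the spectral family of `A`, that is the spectral projection
`χ_{(-∞, λ]}(A)`: the projection onto the kernel of the positive part `(A - λ)⁺` of `A - λ`. -/
def spectralFamily {H : Type*} [NormedAddCommGroup H] [InnerProductSpace ℂ H] [CompleteSpace H]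
    (R : VonNeumannAlgebra H) (A : selfAdjoint R) (l : ℝ) : R.Projections :=
  ⟨(cfc (fun t : ℝ => max (t - l) 0) (A : H →L[ℂ] H)).ker.starProjection,
    isStarProjection_starProjection,
    R.starProjection_mem _ fun y hy x hx => by
      have hc : Commute (A : H →L[ℂ] H) y :=
        VonNeumannAlgebra.mem_commutant_iff.mp hy _ A.1.2
      have h := DFunLike.congr_fun (hc.cfc_real (fun t : ℝ => max (t - l) 0)).eq x
      simp only [LinearMap.mem_ker, ContinuousLinearMap.coe_coe] at hx ⊢
      simpa [hx] using h⟩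

/-- `f_A(J) = inf {λ | E^A_λ ∈ J}`. -/
def observableFunction {H : Type*} [NormedAddCommGroup H] [InnerProductSpace ℂ H]
    [CompleteSpace H] (R : VonNeumannAlgebra H) (A : selfAdjoint R) :
    DualIdeal R.Projections → ℝ :=
  fun J => sInf {l : ℝ | R.spectralFamily A l ∈ J}

end VonNeumannAlgebra

end

/-! Upper semicontinuity makes `f` determined by principal dual ideals: `f J` is the infimum of `f
(principal a)` over `a ∈ J`. The principal ideals of a family of elements intersect in the principal
ideal of their supremum, so by the intersection condition the nonzero `a` with `f (principal a) ≤ l`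
are exactly the nonzero elements below one element `E l`. Hence `E` is increasing and
right-continuous, and `f J = inf {l | E l ∈ J}`. It is bounded because `f` is finite at the
principal ideal of `⊤` and at the dual ideal that the `E l` would generate if none were `⊥`.

For existence, take `A = ∫ l dE l`, obtained by partial integration as `b - ∫ E l dl` over `[a, b]`
in the weak sense; it lies in `R` by the bicommutant property. Each `E l` commutes with `A` and
splits its quadratic form at `l`, and right-continuity then forces `E l` to be the projection onto
the kernel of `(A - l)⁺`.

For uniqueness, the values of `f_A` on principal ideals recover `E^A`. If `A` and `B` have the same
spectral family, then `⟪(A - B) (E l x), x⟫` has increments too small for it to vary with `l`, so `A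
= B`. -/

open scoped InnerProductSpace

/-! ### Dual ideals and abstract observable functions on a complete lattice. -/

namespace DualIdeal

variable {L : Type*} [CompleteLattice L]

theorem mem_of_le {J : DualIdeal L} {a b : L} (ha : a ∈ J) (hab : a ≤ b) : b ∈ J :=
  J.mem_of_le' ha hab

theorem top_mem (J : DualIdeal L) : ⊤ ∈ J :=
  J.nonempty'.elim fun _ ha => J.mem_of_le' ha le_top

theorem isTopologicalBasis_basic :
    TopologicalSpace.IsTopologicalBasis (Set.range (basic : L → Set (DualIdeal L))) := by
  have h : insert Set.univ (Set.range (basic : L → Set (DualIdeal L))) = Set.range basic :=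
    Set.insert_eq_of_mem ⟨⊤, Set.eq_univ_of_forall top_mem⟩
  rw [← h]
  refine TopologicalSpace.isTopologicalBasis_of_subbasis_of_inter rfl ?_
  rintro _ ⟨a, rfl⟩ _ ⟨b, rfl⟩
  refine ⟨a ⊓ b, Set.ext fun J => ⟨fun hJ => ?_, fun hJ => J.inf_mem' hJ.1 hJ.2⟩⟩
  exact ⟨mem_of_le hJ inf_le_left, mem_of_le hJ inf_le_right⟩

theorem mem_sInter {S : Set (DualIdeal L)} {hS : S.Nonempty} {a : L} :
    a ∈ sInter S hS ↔ ∀ J ∈ S, a ∈ J := Iff.rfl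

/-- The principal dual ideal of a nonzero element `a`, that is the set of all `b ≥ a`. -/
def principal (a : L) (ha : a ≠ ⊥) : DualIdeal L where
  carrier := Set.Ici a
  nonempty' := ⟨a, le_rfl⟩
  bot_notMem' := fun h => ha (le_bot_iff.mp h)
  inf_mem' := fun hb hc => le_inf hb hc
  mem_of_le' := fun hb hbc => le_trans hb hbc

@[simp]
theorem mem_principal {a b : L} {ha : a ≠ ⊥} : b ∈ principal a ha ↔ a ≤ b := Iff.rfl

/-- The dual ideal generated by a nonempty chain of nonzero elements. -/
def ofMonotone (E : ℝ → L) (hE : Monotone E) (h : ∀ l, E l ≠ ⊥) : DualIdeal L where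
  carrier := {a | ∃ l, E l ≤ a}
  nonempty' := ⟨E 0, 0, le_rfl⟩
  bot_notMem' := fun ⟨l, hl⟩ => h l (le_bot_iff.mp hl)
  inf_mem' := fun ⟨l, hl⟩ ⟨m, hm⟩ =>
    ⟨min l m, le_inf ((hE (min_le_left _ _)).trans hl) ((hE (min_le_right _ _)).trans hm)⟩
  mem_of_le' := fun ⟨l, hl⟩ hab => ⟨l, hl.trans hab⟩

namespace IsAbstractObservable

variable {f : DualIdeal L → ℝ}

/-- The intersection condition for the pair `{I, J}`, whose intersection is `I`. -/
theorem anti (hf : IsAbstractObservable f) {I J : DualIdeal L} (h : ∀ a ∈ I, a ∈ J) :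
    f J ≤ f I := by
  have h1 : sInter {I, J} ⟨I, by simp⟩ = I := by
    refine SetLike.ext fun a => ⟨fun ha => mem_sInter.mp ha I (by simp), fun ha K hK => ?_⟩
    rcases hK with rfl | rfl
    exacts [ha, h a ha]
  have h2 := (hf.intersection {I, J} ⟨I, by simp⟩).1 ⟨J, by simp, rfl⟩
  rwa [h1] at h2

/-- A basic neighbourhood of `J` on which `f < c` consists of the dual ideals containing some `a ∈
J`, and `principal a` is one of them. -/
theorem exists_principal_lt (hf : IsAbstractObservable f) {J : DualIdeal L} {c : ℝ}
    (h : f J < c) : ∃ a, ∃ ha : a ≠ ⊥, a ∈ J ∧ f (principal a ha) < c := by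
  obtain ⟨_, ⟨a, rfl⟩, haJ, hsub⟩ :=
    isTopologicalBasis_basic.mem_nhds_iff.mp (hf.upperSemicontinuous J c h)
  have ha : a ≠ ⊥ := fun h0 => J.bot_notMem' (h0 ▸ haJ)
  exact ⟨a, ha, haJ, hsub (show a ∈ principal a ha from le_rfl)⟩

/-- The sublevel set is closed under suprema: the principal ideals of its members intersect in the
principal ideal of their supremum `s`, so the intersection condition bounds `f (principal s)` by
`l`. It is a down-set by `anti`. -/
theorem le_sSup_iff (hf : IsAbstractObservable f) {l : ℝ} {a : L} (ha : a ≠ ⊥) :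
    a ≤ sSup {b | ∃ hb : b ≠ ⊥, f (principal b hb) ≤ l} ↔ f (principal a ha) ≤ l := by
  refine ⟨fun h => ?_, fun h => le_sSup ⟨ha, h⟩⟩
  set s := sSup {b | ∃ hb : b ≠ ⊥, f (principal b hb) ≤ l} with hs
  have hs0 : s ≠ ⊥ := fun h0 => ha (le_bot_iff.mp (h0 ▸ h))
  let S : Set (DualIdeal L) := {J | ∃ b, ∃ hb : b ≠ ⊥, f (principal b hb) ≤ l ∧ J = principal b hb}
  have hS : S.Nonempty := by
    by_contra hS
    refine hs0 (le_bot_iff.mp (sSup_le ?_))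
    rintro b ⟨hb, hbl⟩
    exact absurd (show S.Nonempty from ⟨_, b, hb, hbl, rfl⟩) hS
  have hI : sInter S hS = principal s hs0 := by
    refine SetLike.ext fun c => ⟨fun hc => ?_, ?_⟩
    · refine sSup_le ?_
      rintro b ⟨hb, hbl⟩
      exact mem_sInter.mp hc (principal b hb) ⟨b, hb, hbl, rfl⟩
    · rintro hc _ ⟨b, hb, hbl, rfl⟩
      have hbs : b ≤ s := le_sSup ⟨hb, hbl⟩
      exact hbs.trans (mem_principal.mp hc)
  have hle : f (principal s hs0) ≤ l := by
    rw [← hI]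
    refine (hf.intersection S hS).2 ?_
    rintro _ ⟨_, ⟨b, hb, hbl, rfl⟩, rfl⟩
    exact hbl
  exact (hf.anti fun c hc => le_trans h hc).trans hle

/-- An abstract observable function is given by a bounded right-continuous spectral family. -/
theorem exists_spectralFamily (hf : IsAbstractObservable f) :
    ∃ E : ℝ → L, Monotone E ∧ (∀ l a, (∀ m, l < m → a ≤ E m) → a ≤ E l) ∧ (∃ a, E a = ⊥) ∧
      (∃ b, E b = ⊤) ∧ ∀ J, f J = sInf {l | E l ∈ J} := by
  let E : ℝ → L := fun l => sSup {b | ∃ hb : b ≠ ⊥, f (principal b hb) ≤ l}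
  have hE : ∀ {l a} (ha : a ≠ ⊥), a ≤ E l ↔ f (principal a ha) ≤ l := fun ha => hf.le_sSup_iff ha
  have hmono : Monotone E := fun l m hlm =>
    sSup_le_sSup fun b ⟨hb, hbl⟩ => ⟨hb, hbl.trans hlm⟩
  have hle : ∀ {l J}, E l ∈ J → f J ≤ l := fun {l J} h => by
    have h0 : E l ≠ ⊥ := fun h0 => J.bot_notMem' (h0 ▸ h)
    exact (hf.anti fun c hc => mem_of_le h hc).trans ((hE h0).mp le_rfl)
  have htop : ∃ b, E b = ⊤ := by
    -- In the one-element lattice `⊤` generates no dual ideal, and any index works.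
    by_cases h : (⊤ : L) = ⊥
    · exact ⟨0, le_antisymm le_top (h ▸ bot_le)⟩
    · exact ⟨f (principal ⊤ h), top_le_iff.mp ((hE h).mpr le_rfl)⟩
  refine ⟨E, hmono, fun l a h => ?_, ?_, htop, fun J => ?_⟩
  · by_cases ha : a = ⊥
    · exact ha ▸ bot_le
    · exact (hE ha).mpr (le_of_forall_gt_imp_ge_of_dense fun m hm => (hE ha).mp (h m hm))
  -- Otherwise the `E l` generate a dual ideal containing all of them, so `f` there would be at most
  -- every real `l`, in particular at most its own value minus `1`.
  · by_contra! h
    have := hle (J := ofMonotone E hmono h) (l := f (ofMonotone E hmono h) - 1) ⟨_, le_rfl⟩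
    linarith
  · obtain ⟨b, hb⟩ := htop
    refine (IsGLB.csInf_eq ⟨fun l hl => hle hl, fun c hc => ?_⟩ ⟨b, ?_⟩).symm
    · refine le_of_forall_gt_imp_ge_of_dense fun d hd => ?_
      obtain ⟨a, ha, haJ, had⟩ := hf.exists_principal_lt hd
      exact hc (mem_of_le haJ ((hE ha).mpr had.le))
    · exact (hb.symm ▸ J.top_mem : E b ∈ J)

end IsAbstractObservable

/-- A bounded right-continuous family in a complete lattice is determined by its function on the
principal dual ideals. -/
theorem le_iff_sInf_principal_le {E : ℝ → L} (hE : Monotone E)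
    (hright : ∀ l a, (∀ m, l < m → a ≤ E m) → a ≤ E l) (hbot : ∃ a, E a = ⊥)
    (htop : ∃ b, E b = ⊤) {l : ℝ} {a : L} (ha : a ≠ ⊥) :
    a ≤ E l ↔ sInf {m | E m ∈ principal a ha} ≤ l := by
  obtain ⟨c, hc⟩ := hbot
  obtain ⟨b, hb⟩ := htop
  have hbdd : BddBelow {m | E m ∈ principal a ha} := by
    refine ⟨c, fun m hm => le_of_lt (lt_of_not_ge fun hmc => ha (le_bot_iff.mp ?_))⟩
    exact hc ▸ le_trans hm (hE hmc)
  refine ⟨fun h => csInf_le hbdd h, fun h => hright l a fun m hm => ?_⟩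
  obtain ⟨k, hk, hkm⟩ := exists_lt_of_csInf_lt (s := {m | E m ∈ principal a ha})
    ⟨b, by simp [hb]⟩ (h.trans_lt hm)
  exact le_trans hk (hE hkm.le)

end DualIdeal

/-! ### Spectral cuts and the positive and negative parts of `A - l`. -/

namespace ContinuousLinearMap

variable {H : Type*} [NormedAddCommGroup H] [InnerProductSpace ℂ H]

theorem re_inner_sub_smul_one (A : H →L[ℂ] H) (l : ℝ) (x : H) :
    (⟪(A - (l : ℂ) • (1 : H →L[ℂ] H)) x, x⟫_ℂ).re = (⟪A x, x⟫_ℂ).re - l * ‖x‖ ^ 2 := by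
  simp [inner_self_eq_norm_sq_to_K, ← Complex.ofReal_pow]

theorem _root_.Commute.apply_eq {A B : H →L[ℂ] H} (h : Commute A B) (x : H) :
    A (B x) = B (A x) := DFunLike.congr_fun h.eq x

theorem abs_re_inner_apply_self_le (A : H →L[ℂ] H) (x : H) :
    |(⟪A x, x⟫_ℂ).re| ≤ ‖A‖ * ‖x‖ ^ 2 :=
  calc |(⟪A x, x⟫_ℂ).re| ≤ ‖⟪A x, x⟫_ℂ‖ := Complex.abs_re_le_norm _
    _ ≤ ‖A x‖ * ‖x‖ := norm_inner_le_norm _ _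
    _ ≤ ‖A‖ * ‖x‖ * ‖x‖ := mul_le_mul_of_nonneg_right (A.le_opNorm x) (norm_nonneg x)
    _ = ‖A‖ * ‖x‖ ^ 2 := by ring

variable [CompleteSpace H]

/-- The projection `P` commutes with `A` and separates the parts of `A` below and above `l`. -/
structure IsSpectralCut (A P : H →L[ℂ] H) (l : ℝ) : Prop where
  isStarProjection : IsStarProjection P
  commute : Commute A P
  le : ∀ x, P x = x → (⟪A x, x⟫_ℂ).re ≤ l * ‖x‖ ^ 2
  ge : ∀ x, P x = 0 → l * ‖x‖ ^ 2 ≤ (⟪A x, x⟫_ℂ).re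

theorem _root_.IsStarProjection.apply_apply {P : H →L[ℂ] H} (hP : IsStarProjection P) (x : H) :
    P (P x) = P x := DFunLike.congr_fun hP.isIdempotentElem.eq x

theorem _root_.IsStarProjection.inner_apply_left {P : H →L[ℂ] H} (hP : IsStarProjection P)
    (x y : H) : ⟪P x, y⟫_ℂ = ⟪x, P y⟫_ℂ := hP.isSelfAdjoint.isSymmetric x y

theorem _root_.IsStarProjection.inner_apply_self {P : H →L[ℂ] H} (hP : IsStarProjection P)
    (x : H) : ⟪P x, x⟫_ℂ = ((‖P x‖ ^ 2 : ℝ) : ℂ) := by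
  rw [← hP.apply_apply, hP.inner_apply_left, inner_self_eq_norm_sq_to_K, hP.apply_apply]
  simp

/-- A positive operator vanishes wherever its quadratic form does. -/
theorem IsPositive.apply_eq_zero_of_re_inner_nonpos {C : H →L[ℂ] H} (hC : C.IsPositive) {x : H}
    (h : (⟪C x, x⟫_ℂ).re ≤ 0) : C x = 0 := by
  -- With `C = D * D` the form is `⟪C x, x⟫ = ‖D x‖ ^ 2`.
  obtain ⟨D, hD, rfl⟩ : ∃ D : H →L[ℂ] H, IsSelfAdjoint D ∧ D * D = C := by
    have hC' : 0 ≤ C := (nonneg_iff_isPositive C).mpr hC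
    exact ⟨CFC.sqrt C, (CFC.sqrt_nonneg C).isSelfAdjoint, CFC.sqrt_mul_sqrt_self C hC'⟩
  have h1 : ⟪(D * D) x, x⟫_ℂ = ⟪D x, D x⟫_ℂ := hD.isSymmetric (D x) x
  rw [h1, ← RCLike.re_eq_complex_re, inner_self_eq_norm_sq] at h
  have h2 : D x = 0 := norm_eq_zero.mp (pow_eq_zero_iff two_ne_zero |>.mp (h.antisymm (sq_nonneg _)))
  simp [h2]

variable {A : H →L[ℂ] H} {l : ℝ}

/-- The positive part `(A - l)⁺`. -/
noncomputable def posPartSub (A : H →L[ℂ] H) (l : ℝ) : H →L[ℂ] H := cfc (fun t : ℝ => max (t - l) 0) A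

/-- The negative part `(A - l)⁻`. -/
noncomputable def negPartSub (A : H →L[ℂ] H) (l : ℝ) : H →L[ℂ] H := cfc (fun t : ℝ => max (l - t) 0) A

theorem isPositive_posPartSub : (posPartSub A l).IsPositive :=
  (nonneg_iff_isPositive _).mp (cfc_nonneg fun _ _ => le_max_right _ _)

theorem isPositive_negPartSub : (negPartSub A l).IsPositive :=
  (nonneg_iff_isPositive _).mp (cfc_nonneg fun _ _ => le_max_right _ _)

theorem negPartSub_mul_posPartSub : negPartSub A l * posPartSub A l = 0 := by
  rw [posPartSub, negPartSub, ← cfc_mul _ _ A, ← cfc_zero ℝ A]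
  congr 1
  ext t
  rcases le_total t l with h | h <;> simp [h]

theorem posPartSub_mul_negPartSub : posPartSub A l * negPartSub A l = 0 := by
  rw [posPartSub, negPartSub, ← cfc_mul _ _ A, ← cfc_zero ℝ A]
  congr 1
  ext t
  rcases le_total t l with h | h <;> simp [h]

theorem posPartSub_sub_negPartSub (hA : IsSelfAdjoint A) :
    posPartSub A l - negPartSub A l = A - (l : ℂ) • (1 : H →L[ℂ] H) := by
  have h1 : A - (l : ℂ) • (1 : H →L[ℂ] H) = cfc (fun t : ℝ => t - l) A := by
    rw [cfc_sub (fun t : ℝ => t) (fun _ => l) A, cfc_id' ℝ A, cfc_const l A,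
      Algebra.algebraMap_eq_smul_one]
    rfl
  rw [posPartSub, negPartSub, ← cfc_sub _ _ A, h1]
  congr 1
  ext t
  rcases le_total t l with h | h <;> simp [h]

theorem apply_eq_of_posPartSub (hA : IsSelfAdjoint A) (x : H) :
    posPartSub A l x - negPartSub A l x = (A - (l : ℂ) • (1 : H →L[ℂ] H)) x :=
  DFunLike.congr_fun (posPartSub_sub_negPartSub hA) x

theorem _root_.Commute.posPartSub {P : H →L[ℂ] H} (h : Commute A P) :
    Commute (posPartSub A l) P := h.cfc_real _

theorem _root_.Commute.negPartSub {P : H →L[ℂ] H} (h : Commute A P) :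
    Commute (negPartSub A l) P := h.cfc_real _

namespace IsSpectralCut

variable {P : H →L[ℂ] H}

/-- The vector `y = (A - l)⁺ x` stays in the range of `P` and is killed by `(A - l)⁻`. So `⟪(A - l)⁺
y, y⟫ = ⟪(A - l) y, y⟫ ≤ 0`, whence `(A - l)⁺ y = 0` and `‖y‖ ^ 2 = ⟪x, (A - l)⁺ y⟫ = 0`. -/
theorem posPartSub_apply_eq_zero (h : IsSpectralCut A P l) (hA : IsSelfAdjoint A) {x : H}
    (hx : P x = x) : posPartSub A l x = 0 := by
  set y := posPartSub A l x with hy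
  have hPy : P y = y := by rw [hy, ← h.commute.posPartSub.apply_eq, hx]
  have hNy : negPartSub A l y = 0 := DFunLike.congr_fun negPartSub_mul_posPartSub x
  have h1 : posPartSub A l y = 0 := by
    refine isPositive_posPartSub.apply_eq_zero_of_re_inner_nonpos ?_
    have := apply_eq_of_posPartSub (l := l) hA y
    rw [hNy, sub_zero] at this
    rw [this, re_inner_sub_smul_one]
    linarith [h.le y hPy]
  have h2 : ⟪y, y⟫_ℂ = 0 := by
    have : ⟪posPartSub A l x, y⟫_ℂ = ⟪x, posPartSub A l y⟫_ℂ :=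
      isPositive_posPartSub.isSymmetric x y
    rw [← hy] at this
    rw [this, h1, inner_zero_right]
  exact inner_self_eq_zero.mp h2

theorem negPartSub_apply_eq_zero (h : IsSpectralCut A P l) (hA : IsSelfAdjoint A) {x : H}
    (hx : P x = 0) : negPartSub A l x = 0 := by
  set y := negPartSub A l x with hy
  have hPy : P y = 0 := by rw [hy, ← h.commute.negPartSub.apply_eq, hx, map_zero]
  have hNy : posPartSub A l y = 0 := DFunLike.congr_fun posPartSub_mul_negPartSub x
  have h1 : negPartSub A l y = 0 := by
    refine isPositive_negPartSub.apply_eq_zero_of_re_inner_nonpos ?_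
    have := apply_eq_of_posPartSub (l := l) hA y
    rw [hNy, zero_sub, neg_eq_iff_eq_neg] at this
    rw [this, inner_neg_left, Complex.neg_re, re_inner_sub_smul_one]
    linarith [h.ge y hPy]
  have h2 : ⟪y, y⟫_ℂ = 0 := by
    have : ⟪negPartSub A l x, y⟫_ℂ = ⟪x, negPartSub A l y⟫_ℂ :=
      isPositive_negPartSub.isSymmetric x y
    rw [← hy] at this
    rw [this, h1, inner_zero_right]
  exact inner_self_eq_zero.mp h2

end IsSpectralCut

/-- The projection onto the kernel of `(A - l)⁺` is a spectral cut of `A` at `l`. -/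
theorem isSpectralCut_starProjection_ker (hA : IsSelfAdjoint A) :
    IsSpectralCut A (posPartSub A l).ker.starProjection l := by
  have hsymm := hA.isSymmetric
  have hinv : ∀ x ∈ (posPartSub A l).ker, A x ∈ (posPartSub A l).ker := fun x hx => by
    have hx' : posPartSub A l x = 0 := hx
    have := ((Commute.refl A).posPartSub (l := l)).apply_eq x
    rw [hx', map_zero] at this
    exact this
  have hmem : ∀ x, (posPartSub A l).ker.starProjection x = x → posPartSub A l x = 0 := fun x hx =>
    (Submodule.starProjection_eq_self_iff.mp hx : x ∈ (posPartSub A l).ker)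
  refine ⟨isStarProjection_starProjection, ?_, fun x hx => ?_, fun x hx => ?_⟩
  · refine ContinuousLinearMap.ext fun x => ?_
    -- The kernel is invariant under `A`; since `A` is symmetric, so is its orthogonal complement,
    -- and the projection commutes with `A`.
    change A ((posPartSub A l).ker.starProjection x) = (posPartSub A l).ker.starProjection (A x)
    refine (Submodule.eq_starProjection_of_mem_of_inner_eq_zero
      (hinv _ (Submodule.starProjection_apply_mem _ x)) fun w hw => ?_).symm
    rw [← map_sub]
    rw [show ⟪A (x - (posPartSub A l).ker.starProjection x), w⟫_ℂ = _ from hsymm _ _]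
    exact Submodule.starProjection_inner_eq_zero x _ (hinv w hw)
  · have h1 := apply_eq_of_posPartSub (l := l) hA x
    rw [hmem x hx, zero_sub] at h1
    have h2 := re_inner_sub_smul_one A l x
    rw [← h1, inner_neg_left, Complex.neg_re] at h2
    have h3 : 0 ≤ (⟪negPartSub A l x, x⟫_ℂ).re := isPositive_negPartSub.re_inner_nonneg_left x
    linarith
  -- Here `x` is orthogonal to the kernel of `(A - l)⁺`, which contains the range of `(A - l)⁻`;
  -- hence `⟪(A - l)⁻ x, x⟫ = 0`.
  · have hN : negPartSub A l x = 0 := by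
      have h4 : negPartSub A l x ∈ (posPartSub A l).ker :=
        DFunLike.congr_fun posPartSub_mul_negPartSub x
      have h5 : negPartSub A l (negPartSub A l x) ∈ (posPartSub A l).ker :=
        DFunLike.congr_fun posPartSub_mul_negPartSub _
      refine isPositive_negPartSub.apply_eq_zero_of_re_inner_nonpos (le_of_eq ?_)
      have h6 := (posPartSub A l).ker.starProjection_inner_eq_zero x _ h4
      rw [hx, sub_zero] at h6
      rw [← inner_conj_symm, h6]
      simp
    have h1 := apply_eq_of_posPartSub (l := l) hA x
    rw [hN, sub_zero] at h1
    have h2 := re_inner_sub_smul_one A l x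
    rw [← h1] at h2
    have h3 : 0 ≤ (⟪posPartSub A l x, x⟫_ℂ).re := isPositive_posPartSub.re_inner_nonneg_left x
    linarith

/-- The function `max (t - l) 0` is 1-Lipschitz in `l` uniformly in `t`, and the functional calculus
keeps the bound. This yields right-continuity of the spectral family. -/
theorem continuous_posPartSub :
    Continuous (posPartSub A) := by
  refine LipschitzWith.continuous (K := 1) (LipschitzWith.of_dist_le_mul fun l m => ?_)
  rw [dist_eq_norm, posPartSub, posPartSub, ← cfc_sub _ _ A, NNReal.coe_one, one_mul]
  refine norm_cfc_le dist_nonneg fun t _ => ?_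
  rw [Real.dist_eq, Real.norm_eq_abs]
  refine (abs_max_sub_max_le_abs _ _ _).trans (le_of_eq ?_)
  rw [abs_sub_comm l m]
  congr 1
  ring

theorem posPartSub_apply_eq_zero_of_forall_gt {x : H}
    (h : ∀ m, l < m → posPartSub A m x = 0) : posPartSub A l x = 0 := by
  have hc : Filter.Tendsto (fun m => posPartSub A m x) (nhdsWithin l (Set.Ioi l))
      (nhds (posPartSub A l x)) :=
    ((((continuous_posPartSub (A := A)).clm_apply continuous_const).tendsto l).mono_left
      nhdsWithin_le_nhds)
  refine tendsto_nhds_unique hc (tendsto_const_nhds.congr' ?_)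
  filter_upwards [self_mem_nhdsWithin] with m hm
  exact (h m hm).symm

theorem posPartSub_apply_eq_zero_mono {m : ℝ} (hlm : l ≤ m) {x : H}
    (hx : posPartSub A l x = 0) : posPartSub A m x = 0 := by
  have hle : posPartSub A m ≤ posPartSub A l :=
    cfc_mono fun t _ => max_le_max_right 0 (by linarith)
  refine isPositive_posPartSub.apply_eq_zero_of_re_inner_nonpos ?_
  have h := ((le_def _ _).mp hle).re_inner_nonneg_left x
  rw [sub_apply, hx, zero_sub, inner_neg_left, map_neg] at h
  exact neg_nonneg.mp h

theorem IsSpectralCut.eq_zero_of_lt {P : H →L[ℂ] H} (h : IsSpectralCut A P l) (hl : l < -‖A‖)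
    {x : H} (hx : P x = x) : x = 0 := by
  have h1 := h.le x hx
  have h2 := (abs_le.mp (abs_re_inner_apply_self_le A x)).1
  have h3 : ‖x‖ ^ 2 = 0 := by nlinarith [sq_nonneg ‖x‖]
  exact norm_eq_zero.mp (pow_eq_zero_iff two_ne_zero |>.mp h3)

theorem IsSpectralCut.eq_zero_of_gt {P : H →L[ℂ] H} (h : IsSpectralCut A P l) (hl : ‖A‖ < l)
    {x : H} (hx : P x = 0) : x = 0 := by
  have h1 := h.ge x hx
  have h2 := (abs_le.mp (abs_re_inner_apply_self_le A x)).2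
  have h3 : ‖x‖ ^ 2 = 0 := by nlinarith [sq_nonneg ‖x‖]
  exact norm_eq_zero.mp (pow_eq_zero_iff two_ne_zero |>.mp h3)

end ContinuousLinearMap

/-! ### Real functions: increments, and integrals of monotone functions. -/

section RealFunctions

/-- A function whose increments are bounded by `(m - l) * (g m - g l)` is constant. -/
theorem eq_of_abs_sub_le_mul_sub {h g : ℝ → ℝ}
    (hhg : ∀ l m, l ≤ m → |h m - h l| ≤ (m - l) * (g m - g l)) {a b : ℝ} (hab : a ≤ b) :
    h b = h a := by
  -- Cut `[a, b]` into `n + 1` equal pieces: the increments of `g` telescope, leaving the mesh as a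
  -- factor that tends to `0`.
  have key : ∀ n : ℕ, |h b - h a| ≤ (b - a) * (g b - g a) / (n + 1 : ℝ) := fun n => by
    have hn : (0 : ℝ) < n + 1 := by positivity
    set u : ℕ → ℝ := fun k => a + k * ((b - a) / (n + 1)) with hu
    have h0 : u 0 = a := by simp [hu]
    have h1 : u (n + 1) = b := by simp only [hu]; push_cast; field_simp; ring
    have hstep : ∀ k, u (k + 1) - u k = (b - a) / (n + 1) := fun k => by
      simp only [hu]; push_cast; ring
    have hpos : 0 ≤ (b - a) / (n + 1) := div_nonneg (sub_nonneg.mpr hab) hn.le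
    calc |h b - h a| = |∑ k ∈ Finset.range (n + 1), (h (u (k + 1)) - h (u k))| := by
          rw [Finset.sum_range_sub (fun k => h (u k)), h0, h1]
      _ ≤ ∑ k ∈ Finset.range (n + 1), |h (u (k + 1)) - h (u k)| := Finset.abs_sum_le_sum_abs _ _
      _ ≤ ∑ k ∈ Finset.range (n + 1), (b - a) / (n + 1) * (g (u (k + 1)) - g (u k)) := by
          refine Finset.sum_le_sum fun k _ => ?_
          rw [← hstep k]
          exact hhg _ _ (by linarith [hstep k])
      _ = (b - a) * (g b - g a) / (n + 1 : ℝ) := by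
          rw [← Finset.mul_sum, Finset.sum_range_sub (fun k => g (u k)), h0, h1]
          ring
  have hlim : Filter.Tendsto (fun n : ℕ => (b - a) * (g b - g a) / (n + 1 : ℝ)) Filter.atTop
      (nhds 0) := by
    have := (tendsto_one_div_add_atTop_nhds_zero_nat (𝕜 := ℝ)).const_mul ((b - a) * (g b - g a))
    simpa [div_eq_mul_inv] using this
  have := ge_of_tendsto' hlim key
  exact sub_eq_zero.mp (abs_nonpos_iff.mp this)

variable {φ : ℝ → ℝ} {a b m c : ℝ}

theorem Monotone.mul_le_intervalIntegral (hφ : Monotone φ) (h0 : ∀ l, 0 ≤ φ l)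
    (hc : ∀ l, m ≤ l → φ l = c) (ham : a ≤ m) (hab : a ≤ b) :
    (b - m) * c ≤ ∫ l in a..b, φ l := by
  have hc0 : 0 ≤ c := hc m le_rfl ▸ h0 m
  rcases le_total m b with hmb | hmb
  · rw [← intervalIntegral.integral_add_adjacent_intervals (b := m) hφ.intervalIntegrable
      hφ.intervalIntegrable]
    have h1 : 0 ≤ ∫ l in a..m, φ l := intervalIntegral.integral_nonneg ham fun l _ => h0 l
    have h2 : ∫ l in m..b, φ l = (b - m) * c := by
      rw [intervalIntegral.integral_congr (g := fun _ => c), intervalIntegral.integral_const,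
        smul_eq_mul]
      intro l hl
      rw [Set.uIcc_of_le hmb] at hl
      exact hc l hl.1
    linarith
  · exact (mul_nonpos_of_nonpos_of_nonneg (sub_nonpos.mpr hmb) hc0).trans
      (intervalIntegral.integral_nonneg hab fun l _ => h0 l)

theorem Monotone.intervalIntegral_le_mul (hφ : Monotone φ) (hc : ∀ l, φ l ≤ c) (hc0 : 0 ≤ c)
    (h0 : ∀ l, l ≤ m → φ l = 0) (hmb : m ≤ b) (hab : a ≤ b) :
    ∫ l in a..b, φ l ≤ (b - m) * c := by
  have key : ∀ d, d ≤ b → ∫ l in d..b, φ l ≤ (b - d) * c := fun d hd => by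
    have := intervalIntegral.integral_mono_on (μ := MeasureTheory.volume) hd hφ.intervalIntegrable
      intervalIntegrable_const fun l _ => hc l
    simpa using this
  rcases le_total a m with ham | ham
  · rw [← intervalIntegral.integral_add_adjacent_intervals (b := m) hφ.intervalIntegrable
      hφ.intervalIntegrable]
    have h2 : ∫ l in a..m, φ l = 0 := by
      rw [intervalIntegral.integral_congr (g := fun _ => 0), intervalIntegral.integral_zero]
      intro l hl
      rw [Set.uIcc_of_le ham] at hl
      exact h0 l hl.2
    rw [h2, zero_add]
    exact key m hmb
  · exact (key a hab).trans (mul_le_mul_of_nonneg_right (by linarith) hc0)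

end RealFunctions

/-! ### An operator and its family of spectral cuts determine each other. -/

namespace ContinuousLinearMap

variable {H : Type*} [NormedAddCommGroup H] [InnerProductSpace ℂ H] [CompleteSpace H]
  {E : ℝ → H →L[ℂ] H} {A B : H →L[ℂ] H} {a b : ℝ}

theorem apply_apply_of_le_left {P Q : H →L[ℂ] H} (hP : IsStarProjection P)
    (hQ : IsStarProjection Q) (h : P ≤ Q) (x : H) : P (Q x) = P x :=
  DFunLike.congr_fun ((hP.le_iff_mul_eq_left hQ).mp h) x

theorem apply_apply_of_le_right {P Q : H →L[ℂ] H} (hP : IsStarProjection P)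
    (hQ : IsStarProjection Q) (h : P ≤ Q) (x : H) : Q (P x) = P x :=
  DFunLike.congr_fun ((hP.le_iff_mul_eq_right hQ).mp h) x

/-- A self-adjoint operator is determined by a bounded spectral family of spectral cuts. -/
theorem eq_of_isSpectralCut (hE : Monotone E) (hA : IsSelfAdjoint A) (hB : IsSelfAdjoint B)
    (hAE : ∀ l, IsSpectralCut A (E l) l) (hBE : ∀ l, IsSpectralCut B (E l) l)
    (hab : a ≤ b) (ha : E a = 0) (hb : E b = 1) : A = B := by
  have hP : ∀ l, IsStarProjection (E l) := fun l => (hAE l).isStarProjection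
  have hD : IsSelfAdjoint (A - B) := hA.sub hB
  have hcomm : ∀ l, Commute (A - B) (E l) := fun l => (hAE l).commute.sub_left (hBE l).commute
  have key : ∀ x, (⟪(A - B) x, x⟫_ℂ).re = 0 := fun x => by
    have h := eq_of_abs_sub_le_mul_sub (h := fun l => (⟪(A - B) (E l x), x⟫_ℂ).re)
      (g := fun l => ‖E l x‖ ^ 2) (fun l m hlm => ?_) hab
    · simpa [ha, hb] using h
    have hF : IsStarProjection (E m - E l) := ((hP l).le_iff_sub (hP m)).mp (hE hlm)
    -- On the slice between `l` and `m` the forms of `A` and `B` both lie between `l * ‖y‖ ^ 2` and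
    -- `m * ‖y‖ ^ 2`, so they differ by at most `(m - l) * ‖y‖ ^ 2`.
    set y := (E m - E l) x with hy
    have hmy : E m y = y := by
      simp [hy, (hP m).apply_apply, apply_apply_of_le_right (hP l) (hP m) (hE hlm)]
    have hly : E l y = 0 := by
      simp [hy, (hP l).apply_apply, apply_apply_of_le_left (hP l) (hP m) (hE hlm)]
    have h1 : ‖E m x‖ ^ 2 - ‖E l x‖ ^ 2 = ‖y‖ ^ 2 := by
      have h2 := hF.inner_apply_self x
      rw [← hy] at h2
      rw [← Complex.ofReal_inj, ← h2, Complex.ofReal_sub, ← (hP m).inner_apply_self,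
        ← (hP l).inner_apply_self, ← inner_sub_left]
      rfl
    have h3 : (⟪(A - B) (E m x), x⟫_ℂ).re - (⟪(A - B) (E l x), x⟫_ℂ).re
        = (⟪A y, y⟫_ℂ).re - (⟪B y, y⟫_ℂ).re := by
      rw [← Complex.sub_re, ← inner_sub_left, ← map_sub, ← Complex.sub_re, ← inner_sub_left]
      have h4 : ⟪(A - B) y, y⟫_ℂ = ⟪(A - B) y, x⟫_ℂ := by
        conv_lhs => rw [hy, ← hF.inner_apply_left,
          ← ((hcomm m).sub_right (hcomm l)).apply_eq, hF.apply_apply]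
      exact congrArg Complex.re h4.symm
    rw [h1, h3, abs_le]
    have := (hAE m).le y hmy
    have := (hAE l).ge y hly
    have := (hBE m).le y hmy
    have := (hBE l).ge y hly
    constructor <;> linarith
  have h0 : ((A - B : H →L[ℂ] H) : H →ₗ[ℂ] H) = 0 := by
    refine (inner_map_self_eq_zero _).mp fun x => ?_
    have him := hD.isSymmetric.im_inner_apply_self x
    exact Complex.ext (key x) him
  exact sub_eq_zero.mp (ContinuousLinearMap.coe_injective h0)

/-- If `E` is a right-continuous family of spectral cuts of `A`, then `E l` projects onto the
kernel of `(A - l)⁺`. -/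
theorem posPartSub_apply_eq_zero_iff (hA : IsSelfAdjoint A) (hAE : ∀ l, IsSpectralCut A (E l) l)
    (hright : ∀ l x, (∀ m, l < m → E m x = x) → E l x = x) {l : ℝ} {x : H} :
    posPartSub A l x = 0 ↔ E l x = x := by
  have hP : ∀ l, IsStarProjection (E l) := fun l => (hAE l).isStarProjection
  refine ⟨fun hx => ?_, fun hx => (hAE l).posPartSub_apply_eq_zero hA hx⟩
  -- Both parts of `A - l` vanish on `z`, so `z` is an eigenvector for `l` or zero. It must vanish,
  -- since right-continuity will place it in the range of `E l`.
  set z := x - E l x with hz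
  have hlz : E l z = 0 := by simp [hz, (hP l).apply_apply]
  have hAz : A z = (l : ℂ) • z := by
    have h1 := apply_eq_of_posPartSub (l := l) hA z
    have h2 : posPartSub A l z = 0 := by
      rw [hz, map_sub, hx, (hAE l).posPartSub_apply_eq_zero hA ((hP l).apply_apply x), sub_zero]
    rw [h2, (hAE l).negPartSub_apply_eq_zero hA hlz, sub_zero] at h1
    exact sub_eq_zero.mp h1.symm
  have hz0 : E l z = z := hright l z fun m hm => by
    -- Still `A y = l • y`, but above the cut at `m > l` the form is at least `m * ‖y‖ ^ 2`; so `y =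
    -- 0`.
    set y := z - E m z with hy
    have hmy : E m y = 0 := by simp [hy, (hP m).apply_apply]
    have hAy : A y = (l : ℂ) • y := by
      rw [hy, map_sub, (hAE m).commute.apply_eq, hAz, map_smul, ← smul_sub]
    have h1 := (hAE m).ge y hmy
    rw [hAy, inner_smul_left, inner_self_eq_norm_sq_to_K] at h1
    have h2 : m * ‖y‖ ^ 2 ≤ l * ‖y‖ ^ 2 := by simpa [← Complex.ofReal_pow] using h1
    have h3 : ‖y‖ ^ 2 = 0 := by nlinarith [sq_nonneg ‖y‖]
    have h4 : y = 0 := norm_eq_zero.mp (pow_eq_zero_iff two_ne_zero |>.mp h3)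
    exact (sub_eq_zero.mp h4).symm
  rw [hlz] at hz0
  exact (sub_eq_zero.mp hz0.symm).symm

end ContinuousLinearMap

/-! ### The operator of a bounded spectral family as a weak integral. -/

namespace ContinuousLinearMap

variable {H : Type*} [NormedAddCommGroup H] [InnerProductSpace ℂ H] [CompleteSpace H]
  {E : ℝ → H →L[ℂ] H} {a b : ℝ}

theorem _root_.IsStarProjection.norm_apply_le {P : H →L[ℂ] H} (hP : IsStarProjection P) (x : H) :
    ‖P x‖ ≤ ‖x‖ :=
  (P.le_of_opNorm_le (IsStarProjection.norm_le P hP) x).trans_eq (one_mul _)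

theorem monotone_norm_apply_sq (hE : Monotone E) (hP : ∀ l, IsStarProjection (E l)) (x : H) :
    Monotone fun l => ‖E l x‖ ^ 2 := fun l m hlm => by
  have h := (hP l).norm_apply_le (E m x)
  rw [apply_apply_of_le_left (hP l) (hP m) (hE hlm)] at h
  exact pow_le_pow_left₀ (norm_nonneg _) h 2

/-- The diagonal terms `‖E l z‖ ^ 2` are monotone in `l`, hence integrable; polarization gives the
rest. -/
theorem intervalIntegrable_inner_apply (hE : Monotone E) (hP : ∀ l, IsStarProjection (E l))
    (x y : H) : IntervalIntegrable (fun l => ⟪E l x, y⟫_ℂ) MeasureTheory.volume a b := by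
  have hself : ∀ z, IntervalIntegrable (fun l => ⟪E l z, z⟫_ℂ) MeasureTheory.volume a b :=
    fun z => by
      simp only [(hP _).inner_apply_self]
      have h := (monotone_norm_apply_sq hE hP z).intervalIntegrable (μ := MeasureTheory.volume)
        (a := a) (b := b)
      exact ⟨h.1.ofReal, h.2.ofReal⟩
  have hpol : (fun l => ⟪E l x, y⟫_ℂ) = fun l =>
      (⟪E l (x + y), x + y⟫_ℂ - ⟪E l (x - y), x - y⟫_ℂ
        - Complex.I * ⟪E l (x + Complex.I • y), x + Complex.I • y⟫_ℂ
        + Complex.I * ⟪E l (x - Complex.I • y), x - Complex.I • y⟫_ℂ) / 4 :=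
    funext fun l => inner_map_polarization' (E l : H →ₗ[ℂ] H) x y
  rw [hpol]
  exact ((((hself _).sub (hself _)).sub ((hself _).const_mul _)).add
    ((hself _).const_mul _)).div_const _

/-- The weak integral `∫ E l dl` of a monotone family of projections over `[a, b]`. -/
theorem exists_weak_integral (hE : Monotone E) (hP : ∀ l, IsStarProjection (E l)) (a b : ℝ) :
    ∃ T : H →L[ℂ] H, ∀ x y, ⟪T x, y⟫_ℂ = ∫ l in a..b, ⟪E l x, y⟫_ℂ := by
  have hint := fun x y => intervalIntegrable_inner_apply (a := a) (b := b) hE hP x y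
  let F : H →ₗ⋆[ℂ] H →ₗ[ℂ] ℂ := LinearMap.mk₂'ₛₗ (starRingEnd ℂ) (RingHom.id ℂ)
    (fun x y => ∫ l in a..b, ⟪E l x, y⟫_ℂ)
    (fun x x' y => by
      simp only [map_add, inner_add_left]
      exact intervalIntegral.integral_add (hint x y) (hint x' y))
    (fun c x y => by
      simp only [map_smul, inner_smul_left]
      exact intervalIntegral.integral_const_mul _ _)
    (fun x y y' => by
      simp only [inner_add_right]
      exact intervalIntegral.integral_add (hint x y) (hint x y'))
    (fun c x y => by
      simp only [inner_smul_right]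
      exact intervalIntegral.integral_const_mul _ _)
  have hF : ∀ x y, ‖F x y‖ ≤ |b - a| * ‖x‖ * ‖y‖ := fun x y => by
    refine (intervalIntegral.norm_integral_le_of_norm_le_const (C := ‖x‖ * ‖y‖)
      fun l _ => ?_).trans (le_of_eq (by ring))
    exact (norm_inner_le_norm _ _).trans
      (mul_le_mul_of_nonneg_right ((hP l).norm_apply_le x) (norm_nonneg y))
  exact ⟨InnerProductSpace.continuousLinearMapOfBilin (F.mkContinuous₂ _ hF), fun x y =>
    InnerProductSpace.continuousLinearMapOfBilin_apply _ x y⟩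

/-- The operator `A = ∫ l dE l` of a bounded spectral family, by partial integration. -/
theorem exists_isSpectralCut (hE : Monotone E) (hP : ∀ l, IsStarProjection (E l)) (hab : a ≤ b)
    (ha : E a = 0) (hb : E b = 1) :
    ∃ A : H →L[ℂ] H, IsSelfAdjoint A ∧ (∀ B, (∀ l, Commute B (E l)) → Commute B A) ∧
      ∀ l, IsSpectralCut A (E l) l := by
  obtain ⟨T, hT⟩ := exists_weak_integral hE hP a b
  have hTcomm : ∀ B, (∀ l, Commute B (E l)) → Commute B T := fun B hB => by
    refine ContinuousLinearMap.ext fun x => ext_inner_right ℂ fun y => ?_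
    change ⟪B (T x), y⟫_ℂ = ⟪T (B x), y⟫_ℂ
    rw [← ContinuousLinearMap.adjoint_inner_right, hT, hT]
    simp only [ContinuousLinearMap.adjoint_inner_right, (hB _).apply_eq]
  have hTsa : IsSelfAdjoint T := by
    rw [ContinuousLinearMap.isSelfAdjoint_iff_isSymmetric]
    intro x y
    change ⟪T x, y⟫_ℂ = ⟪x, T y⟫_ℂ
    rw [← inner_conj_symm x, hT, hT, ← intervalIntegral.intervalIntegral_conj]
    simp only [inner_conj_symm, (hP _).inner_apply_left]
  have hTself : ∀ x, (⟪T x, x⟫_ℂ).re = ∫ l in a..b, ‖E l x‖ ^ 2 := fun x => by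
    rw [hT]
    simp only [(hP _).inner_apply_self]
    rw [intervalIntegral.integral_ofReal, Complex.ofReal_re]
  have hAself : ∀ x, (⟪((b : ℂ) • (1 : H →L[ℂ] H) - T) x, x⟫_ℂ).re
      = b * ‖x‖ ^ 2 - ∫ l in a..b, ‖E l x‖ ^ 2 := fun x => by
    rw [← hTself]
    simp [inner_self_eq_norm_sq_to_K, ← Complex.ofReal_pow]
  have hcomm : ∀ B, (∀ l, Commute B (E l)) → Commute B ((b : ℂ) • (1 : H →L[ℂ] H) - T) :=
    fun B hB => ((Commute.one_right B).smul_right _).sub_right (hTcomm B hB)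
  -- Partial integration of `∫ l dE l` with `E a = 0` and `E b = 1` leaves `b - ∫ E l dl`.
  refine ⟨(b : ℂ) • 1 - T, ?_, hcomm, fun m => ⟨hP m, ?_, fun x hx => ?_, fun x hx => ?_⟩⟩
  · refine IsSelfAdjoint.sub (IsSelfAdjoint.smul ?_ (IsSelfAdjoint.one _)) hTsa
    exact Complex.conj_ofReal b
  · refine (hcomm _ fun l => ?_).symm
    rcases le_total m l with h | h
    · exact (hP m).commute_of_le (hP l) (hE h)
    · exact ((hP l).commute_of_le (hP m) (hE h)).symm
  · rw [hAself]
    rcases le_total a m with ham | hma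
    -- For `l ≥ m` the projection `E l` fixes `x`, so the integral is at least `(b - m) * ‖x‖ ^ 2`.
    · have := (monotone_norm_apply_sq hE hP x).mul_le_intervalIntegral (c := ‖x‖ ^ 2)
        (fun l => sq_nonneg _) (fun l hl => ?_) ham hab
      · linarith
      · rw [← hx, apply_apply_of_le_right (hP m) (hP l) (hE hl)]
    · have hx0 : x = 0 := by
        rw [← hx, ← apply_apply_of_le_left (hP m) (hP a) (hE hma), ha, zero_apply, map_zero]
      simp [hx0]
  · rw [hAself]
    rcases le_total m b with hmb | hbm
    -- For `l ≤ m` the projection `E l` kills `x`, so the integral is at most `(b - m) * ‖x‖ ^ 2`.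
    · have := (monotone_norm_apply_sq hE hP x).intervalIntegral_le_mul (c := ‖x‖ ^ 2) (m := m)
        (fun l => pow_le_pow_left₀ (norm_nonneg _) ((hP l).norm_apply_le x) 2) (sq_nonneg _)
        (fun l hl => ?_) hmb hab
      · linarith
      · rw [← apply_apply_of_le_left (hP l) (hP m) (hE hl), hx]
        simp
    · have hx0 : x = 0 := by
        have h := apply_apply_of_le_right (hP b) (hP m) (hE hbm) x
        rw [hb] at h
        exact h.symm.trans hx
      simp [hx0]

end ContinuousLinearMap

/-! ### Spectral families and observable functions in the von Neumann algebra. -/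

namespace VonNeumannAlgebra

open ContinuousLinearMap

variable {H : Type*} [NormedAddCommGroup H] [InnerProductSpace ℂ H] [CompleteSpace H]
  {R : VonNeumannAlgebra H}

namespace Projections

theorem apply_eq_self_iff (P : R.Projections) (x : H) : P.1 x = x ↔ x ∈ P.1.range :=
  ⟨fun h => ⟨x, h⟩, fun ⟨y, hy⟩ => hy ▸ P.2.1.apply_apply y⟩

theorem range_sInf (S : Set R.Projections) :
    (sInf S).1.range = (⨅ P ∈ S, P.1.range : Submodule ℂ H) :=
  Submodule.range_starProjection _

theorem coe_eq_zero_iff {P : R.Projections} : P.1 = 0 ↔ P = ⊥ := by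
  let Z : R.Projections := ⟨0, IsStarProjection.zero _, zero_mem _⟩
  have hZ : Z = ⊥ := le_bot_iff.mp <| (le_iff_range Z ⊥).mpr fun x ⟨y, hy⟩ => by
    have : x = 0 := hy.symm
    exact this ▸ zero_mem _
  rw [← hZ]
  exact ⟨fun h => Subtype.ext h, fun h => congrArg Subtype.val h⟩

theorem coe_eq_one_iff {P : R.Projections} : P.1 = 1 ↔ P = ⊤ := by
  let Z : R.Projections := ⟨1, IsStarProjection.one _, one_mem _⟩
  have hZ : Z = ⊤ := top_le_iff.mp <| (le_iff_range ⊤ Z).mpr fun x _ => ⟨x, rfl⟩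
  rw [← hZ]
  exact ⟨fun h => Subtype.ext h, fun h => congrArg Subtype.val h⟩

/-- Right-continuity of a family of projections, in terms of vectors. -/
theorem apply_eq_self_of_forall_gt {E : ℝ → R.Projections}
    (hright : ∀ l P, (∀ m, l < m → P ≤ E m) → P ≤ E l) (l : ℝ) (x : H)
    (h : ∀ m, l < m → (E m).1 x = x) : (E l).1 x = x := by
  -- The lattice condition is tested on the meet of the later projections, whose range is the
  -- intersection of their ranges.
  have hle : sInf (E '' Set.Ioi l) ≤ E l := hright l _ fun m hm => sInf_le ⟨m, hm, rfl⟩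
  rw [apply_eq_self_iff]
  refine (le_iff_range _ _).mp hle ?_
  rw [range_sInf]
  simp only [Submodule.mem_iInf]
  rintro _ ⟨m, hm, rfl⟩
  exact (apply_eq_self_iff _ _).mp (h m hm)

end Projections

theorem isSelfAdjoint_coe (A : selfAdjoint R) : IsSelfAdjoint (A : H →L[ℂ] H) :=
  congrArg Subtype.val A.2

theorem isSpectralCut_spectralFamily (A : selfAdjoint R) (l : ℝ) :
    IsSpectralCut (A : H →L[ℂ] H) (R.spectralFamily A l).1 l :=
  isSpectralCut_starProjection_ker (isSelfAdjoint_coe A)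

theorem mem_range_spectralFamily {A : selfAdjoint R} {l : ℝ} {x : H} :
    x ∈ (R.spectralFamily A l).1.range ↔ posPartSub (A : H →L[ℂ] H) l x = 0 := by
  rw [show (R.spectralFamily A l).1.range = (posPartSub (A : H →L[ℂ] H) l).ker from
    Submodule.range_starProjection _]
  rfl

theorem spectralFamily_rightContinuous (A : selfAdjoint R) (l : ℝ) (P : R.Projections)
    (h : ∀ m, l < m → P ≤ R.spectralFamily A m) : P ≤ R.spectralFamily A l := by
  rw [Projections.le_iff_range]
  intro x hx
  rw [mem_range_spectralFamily]
  refine posPartSub_apply_eq_zero_of_forall_gt fun m hm => ?_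
  rw [← mem_range_spectralFamily]
  exact (Projections.le_iff_range _ _).mp (h m hm) hx

theorem spectralFamily_mono (A : selfAdjoint R) : Monotone (R.spectralFamily A) := by
  intro l m hlm
  rw [Projections.le_iff_range]
  intro x hx
  rw [mem_range_spectralFamily] at hx ⊢
  exact posPartSub_apply_eq_zero_mono hlm hx

theorem spectralFamily_of_lt (A : selfAdjoint R) {l : ℝ} (hl : l < -‖(A : H →L[ℂ] H)‖) :
    R.spectralFamily A l = ⊥ := by
  rw [← Projections.coe_eq_zero_iff]
  refine ContinuousLinearMap.ext fun x => ?_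
  have hcut := isSpectralCut_spectralFamily A l
  exact hcut.eq_zero_of_lt hl (hcut.isStarProjection.apply_apply x)

theorem spectralFamily_of_gt (A : selfAdjoint R) {l : ℝ} (hl : ‖(A : H →L[ℂ] H)‖ < l) :
    R.spectralFamily A l = ⊤ := by
  rw [← Projections.coe_eq_one_iff]
  refine ContinuousLinearMap.ext fun x => ?_
  have hcut := isSpectralCut_spectralFamily A l
  have h := hcut.eq_zero_of_gt hl (x := x - (R.spectralFamily A l).1 x)
    (by rw [map_sub, hcut.isStarProjection.apply_apply, sub_self])
  exact (sub_eq_zero.mp h).symm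

theorem spectralFamily_injective : Function.Injective (R.spectralFamily) := by
  intro A B h
  -- The added `1` makes `c` strictly larger than both norms, so that the family is `⊥` at `-c` and
  -- `⊤` at `c`.
  set c := max ‖(A : H →L[ℂ] H)‖ ‖(B : H →L[ℂ] H)‖ + 1 with hc
  have hAc : ‖(A : H →L[ℂ] H)‖ < c := (le_max_left _ _).trans_lt (lt_add_one _)
  have hc0 : 0 ≤ c := (norm_nonneg _).trans hAc.le
  refine Subtype.ext (Subtype.ext ?_)
  refine eq_of_isSpectralCut (E := fun l => (R.spectralFamily A l).1) (a := -c) (b := c)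
    (spectralFamily_mono A) (isSelfAdjoint_coe A) (isSelfAdjoint_coe B)
    (isSpectralCut_spectralFamily A) (fun l => ?_) (by linarith)
    (Projections.coe_eq_zero_iff.mpr (spectralFamily_of_lt A (neg_lt_neg hAc)))
    (Projections.coe_eq_one_iff.mpr (spectralFamily_of_gt A hAc))
  simp only [h]
  exact isSpectralCut_spectralFamily B l

/-- By right-continuity, the value at the principal ideal of `P` tells for which `l` the projection
`P` lies below `E^A_l`; this recovers the spectral family and hence `A`. -/
theorem observableFunction_injective : Function.Injective (R.observableFunction) := by
  intro A B h
  refine spectralFamily_injective (funext fun l => eq_of_forall_le_iff fun P => ?_)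
  by_cases hP : P = ⊥
  · simp [hP]
  have key : ∀ C : selfAdjoint R, P ≤ R.spectralFamily C l ↔
      R.observableFunction C (DualIdeal.principal P hP) ≤ l := fun C =>
    DualIdeal.le_iff_sInf_principal_le (spectralFamily_mono C) (spectralFamily_rightContinuous C)
      ⟨_, spectralFamily_of_lt C (sub_one_lt _)⟩ ⟨_, spectralFamily_of_gt C (lt_add_one _)⟩ hP
  rw [key, key, h]

/-- Every bounded right-continuous spectral family in `R` is that of a self-adjoint element. -/
theorem exists_spectralFamily_eq {E : ℝ → R.Projections} (hE : Monotone E)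
    (hright : ∀ l P, (∀ m, l < m → P ≤ E m) → P ≤ E l) (hbot : ∃ a, E a = ⊥)
    (htop : ∃ b, E b = ⊤) : ∃ A : selfAdjoint R, R.spectralFamily A = E := by
  obtain ⟨a, ha⟩ := hbot
  obtain ⟨b, hb⟩ := htop
  -- When `H` is trivial `⊥ = ⊤`, so `a ≤ b` is not automatic.
  have hb' : E (max a b) = ⊤ := top_le_iff.mp (hb ▸ hE (le_max_right a b))
  obtain ⟨A, hA, hcomm, hcut⟩ := exists_isSpectralCut (E := fun l => (E l).1) hE
    (fun l => (E l).2.1) (le_max_left a b) (Projections.coe_eq_zero_iff.mpr ha)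
    (Projections.coe_eq_one_iff.mpr hb')
  have hAR : A ∈ R := by
    -- An element of the commutant commutes with every `E l`, hence with `A`.
    rw [← R.commutant_commutant, mem_commutant_iff]
    exact fun g hg => (hcomm g fun l => (mem_commutant_iff.mp hg _ (E l).2.2).symm).eq
  refine ⟨⟨⟨A, hAR⟩, Subtype.ext hA⟩, funext fun l => ?_⟩
  have key : ∀ x, x ∈ (R.spectralFamily ⟨⟨A, hAR⟩, Subtype.ext hA⟩ l).1.range ↔
      x ∈ (E l).1.range := fun x => by
    rw [mem_range_spectralFamily, ← Projections.apply_eq_self_iff]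
    exact posPartSub_apply_eq_zero_iff hA hcut (Projections.apply_eq_self_of_forall_gt hright)
  refine le_antisymm ?_ ?_ <;> rw [Projections.le_iff_range]
  exacts [fun x => (key x).mp, fun x => (key x).mpr]

end VonNeumannAlgebra

theorem mainTheorem1 {H : Type*} [NormedAddCommGroup H] [InnerProductSpace ℂ H]
    [CompleteSpace H] (R : VonNeumannAlgebra H) (f : DualIdeal R.Projections → ℝ)
    (hf : DualIdeal.IsAbstractObservable f) :
    ∃! A : selfAdjoint R, f = R.observableFunction A := by
  obtain ⟨E, hE, hright, hbot, htop, hfE⟩ := hf.exists_spectralFamily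
  obtain ⟨A, hA⟩ := VonNeumannAlgebra.exists_spectralFamily_eq hE hright hbot htop
  have hfA : f = R.observableFunction A := by
    funext J
    rw [hfE J, ← hA]
    rfl
  exact ⟨A, hfA, fun B hB => VonNeumannAlgebra.observableFunction_injective (hB.symm.trans hfA)⟩
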